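/- Let $T>0$ and let $(\Omega,\mathcal A,\mathbb P)$ be a complete probability space with a filtration $\mathbb F=(\mathcal F_t)_{t\in[0,T]}$ satisfying the usual conditions. For a process $X=(X_t)_{t\in[0,T]}$ with values in a finite set $S$, let $\mathbb F^X=(\mathcal F^X_t)_{t\in[0,T]}$ be the completed right-continuous filtration generated by $X$. An $S$-valued process $X$ with càdlàg paths is an $(\mathbb F,\mathbb F^X)$-CDMC if it is both - an $(\mathbb F,\mathbb F^X)$-conditional Markov chain: for all $k$, all $x_1,\dots,x_k\in S$ and all $0\le t\le t_1\le\dots\le t_k\le T$, $$\mathbb P(X_{t_1}=x_1,\dots,X_{t_k}=x_k\mid\mathcal F_t\vee\mathcal F^X_t)=\mathbb P(X_{t_1}=x_1,\dots,X_{t_k}=x_k\mid\mathcal F_t\vee\sigma(X_t))\quad\text{a.s.},$$ - and an $(\mathbb F,\mathbb F^X)$-doubly stochastic Markov chain: for all $0\le s\le t\le T$ and all $y\in S$, $$\mathbb P(X_t=y\mid\mathcal F_T\vee\mathcal F^X_s)=\mathbb P(X_t=y\mid\mathcal F_t\vee\sigma(X_s))\quad\text{a.s.}$$ Its c-transition field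 $P(s,t)=[p_{xy}(s,t)]_{x,y\in S}$, $0\le s\le t\le T$, is given (each $P(s,t)$ up to a null set) by $$p_{xy}(s,t)=\frac{\mathbb P(X_t=y,X_s=x\mid\mathcal F_t)}{\mathbb P(X_s=x\mid\mathcal F_t)}\mathbf 1_{\{\mathbb P(X_s=x\mid\mathcal F_t)>0\}}+\mathbf 1_{\{x=y\}}\mathbf 1_{\{\mathbb P(X_s=x\mid\mathcal F_t)=0\}}.$$ An intensity of $X$ is an $\mathbb F$-adapted, jointly measurable, $S\times S$-matrix-valued process $\Gamma=[\gamma^{xy}_t]$ such that, almost surely, $\int_0^T\sum_{x}|\gamma^{xx}_s|\,ds<\infty$, $\gamma^{xy}_s\ge0$ for $x\ne y$, $\gamma^{xx}_s=-\sum_{y\ne x}\gamma^{xy}_s$, and, for a suitable version of the c-transition field, the Kolmogorov equations $$P(v,t)-I=\int_v^t\Gamma_uP(u,t)\,du,\qquad P(v,t)-I=\int_v^tP(v,u)\Gamma_u\,du,\qquad 0\le v\le t\le T,$$ hold. Let $Z$ be an $(\mathbb F,\mathbb F^Z)$-CDMC and let $U$ be an $(\mathbb F,\mathbb F^U)$-CDMC,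 both defined on $(\Omega,\mathcal A,\mathbb P)$ with values in the same finite set $S$, with intensities $\Gamma^Z$ and $\Gamma^U$ respectively. Then the conditional law of $Z$ given $\mathcal F_T$ coincides with the conditional law of $U$ given $\mathcal F_T$, that is, $\mathbb P(Z\in C\mid\mathcal F_T)=\mathbb P(U\in C\mid\mathcal F_T)$ a.s. for every product-measurable set $C\subseteq S^{[0,T]}$ of paths, if and only if $$\Gamma^Z=\Gamma^U\quad du\otimes d\mathbb P\text{-a.e. on }[0,T]\times\Omega,$$ and $$\mathbb P(Z_0=x\mid\mathcal F_T)=\mathbb P(U_0=x\mid\mathcal F_T)\quad\text{a.s., for all }x\in S.$$ -/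

import Mathlib

open MeasureTheory ProbabilityTheory Filter Topology

namespace CondMarkov

/-- The time interval `[0, T]`, with its order and its topology. -/
abbrev Time (T : ℝ) : Type := Set.Icc (0 : ℝ) T

/-- Lebesgue measure on `[0, T]`. -/
noncomputable def lebesgue (T : ℝ) : Measure (Time T) := Measure.comap Subtype.val volume

/-- The initial time `0`. -/
def initialTime {T : ℝ} (hT : 0 < T) : Time T := ⟨0, le_refl 0, hT.le⟩

/-- The time horizon `T`. -/
def horizon {T : ℝ} (hT : 0 < T) : Time T := ⟨T, hT.le, le_refl T⟩

variable {T : ℝ} {Ω S : Type*} [mΩ : MeasurableSpace Ω]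

/-- The usual conditions: every null set belongs to every `ℱ t`, and `ℱ` is right-continuous. -/
structure UsualConditions (μ : Measure Ω) (ℱ : Filtration (Time T) mΩ) : Prop where
  null_mem : ∀ (t : Time T) (N : Set Ω), μ N = 0 → MeasurableSet[ℱ t] N
  rightCont : ℱ.IsRightContinuous

/-- The σ-algebra generated by the (measurable) null sets. -/
@[reducible] def nullSigma (μ : Measure Ω) : MeasurableSpace Ω :=
  MeasurableSpace.generateFrom {N | MeasurableSet N ∧ μ N = 0}

theorem nullSigma_le (μ : Measure Ω) : nullSigma μ ≤ mΩ :=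
  MeasurableSpace.generateFrom_le fun _ h => h.1

/-- The filtration `t ↦ σ(X s : s ≤ t)` completed with the null sets. -/
def completedNaturalFiltration [MeasurableSpace S] (μ : Measure Ω) (X : Time T → Ω → S)
    (hX : ∀ t, Measurable (X t)) : Filtration (Time T) mΩ where
  seq t := (⨆ s ≤ t, MeasurableSpace.comap (X s) inferInstance) ⊔ nullSigma μ
  mono' _ _ h := sup_le_sup_right (biSup_mono fun _ hs => le_trans hs h) _
  le' _ := sup_le (iSup₂_le fun s _ => (hX s).comap_le) (nullSigma_le μ)

/-- `𝔽^X`: the completed right-continuous filtration generated by the process `X`. -/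
noncomputable def processFiltration [MeasurableSpace S] (μ : Measure Ω) (X : Time T → Ω → S)
    (hX : ∀ t, Measurable (X t)) : Filtration (Time T) mΩ :=
  (completedNaturalFiltration μ X hX).rightCont

/-- A path with values in a set carrying the discrete topology is càdlàg: it is right-continuous
and has left limits. -/
def IsCadlagPath (x : Time T → S) : Prop :=
  ∀ t, (∀ᶠ s in 𝓝[>] t, x s = x t) ∧ ∃ a, ∀ᶠ s in 𝓝[<] t, x s = a

/-- `(ℱ, 𝒢)`-conditional Markov chain (CMC). -/
structure IsCMC [MeasurableSpace S] (μ : Measure Ω) (ℱ 𝒢 : Filtration (Time T) mΩ)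
    (X : Time T → Ω → S) : Prop where
  adapted : Adapted 𝒢 X
  cadlag : ∀ᵐ ω ∂μ, IsCadlagPath fun t => X t ω
  condMarkov : ∀ (k : ℕ) (t : Time T) (τ : Fin k → Time T) (x : Fin k → S),
    Monotone τ → (∀ i, t ≤ τ i) →
      μ⟦{ω | ∀ i, X (τ i) ω = x i} | ℱ t ⊔ 𝒢 t⟧
        =ᵐ[μ] μ⟦{ω | ∀ i, X (τ i) ω = x i} | ℱ t ⊔ MeasurableSpace.comap (X t) inferInstance⟧

/-- `(ℱ, 𝒢)`-doubly stochastic Markov chain (DSMC). -/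
structure IsDSMC [MeasurableSpace S] (hT : 0 < T) (μ : Measure Ω)
    (ℱ 𝒢 : Filtration (Time T) mΩ) (X : Time T → Ω → S) : Prop where
  adapted : Adapted 𝒢 X
  cadlag : ∀ᵐ ω ∂μ, IsCadlagPath fun t => X t ω
  doublyStochastic : ∀ (s t : Time T) (y : S), s ≤ t →
    μ⟦{ω | X t ω = y} | ℱ (horizon hT) ⊔ 𝒢 s⟧
      =ᵐ[μ] μ⟦{ω | X t ω = y} | ℱ t ⊔ MeasurableSpace.comap (X s) inferInstance⟧

/-- `P` is (a version of) the conditional transition probability matrix field of `X`: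
`p_{xy}(s,t) = ℙ(X_t = y, X_s = x | ℱ_t) / ℙ(X_s = x | ℱ_t)` where the denominator is positive, and
`p_{xy}(s,t) = 𝟙{x = y}` where it vanishes. Conditional probabilities being defined up to null
sets, so is `P s t` for every `s ≤ t`. -/
def IsCTransitionField [DecidableEq S] (μ : Measure Ω) (ℱ : Filtration (Time T) mΩ)
    (X : Time T → Ω → S) (P : Time T → Time T → Ω → Matrix S S ℝ) : Prop :=
  ∀ (s t : Time T), s ≤ t → ∀ x y : S, ∀ᵐ ω ∂μ,
    P s t ω x y =
      if 0 < (μ⟦{ω' | X s ω' = x} | ℱ t⟧) ω then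
        (μ⟦{ω' | X t ω' = y ∧ X s ω' = x} | ℱ t⟧) ω / (μ⟦{ω' | X s ω' = x} | ℱ t⟧) ω
      else if x = y then 1 else 0

/-- Kolmogorov's backward equation for one path:
`P(v,t) - I = ∫_v^t Γ_u P(u,t) du` for all `v ≤ t`, the integrals being finite. -/
def BackwardEquation [Fintype S] [DecidableEq S] (Γ : Time T → Matrix S S ℝ)
    (P : Time T → Time T → Matrix S S ℝ) : Prop :=
  ∀ v t : Time T, v ≤ t → ∀ x y : S,
    IntegrableOn (fun u => (Γ u * P u t) x y) (Set.Ioc v t) (lebesgue T) ∧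
    (P v t - 1) x y = ∫ u in Set.Ioc v t, (Γ u * P u t) x y ∂(lebesgue T)

/-- Kolmogorov's forward equation for one path:
`P(v,t) - I = ∫_v^t P(v,u) Γ_u du` for all `v ≤ t`, the integrals being finite. -/
def ForwardEquation [Fintype S] [DecidableEq S] (Γ : Time T → Matrix S S ℝ)
    (P : Time T → Time T → Matrix S S ℝ) : Prop :=
  ∀ v t : Time T, v ≤ t → ∀ x y : S,
    IntegrableOn (fun u => (P v u * Γ u) x y) (Set.Ioc v t) (lebesgue T) ∧
    (P v t - 1) x y = ∫ u in Set.Ioc v t, (P v u * Γ u) x y ∂(lebesgue T)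

/-- The `ℱ`-adapted (measurable) matrix-valued process `Γ` is an intensity of the doubly stochastic
Markov chain `X`. -/
structure IsIntensity [Fintype S] [DecidableEq S] (μ : Measure Ω)
    (ℱ : Filtration (Time T) mΩ) (X : Time T → Ω → S) (Γ : Time T → Ω → Matrix S S ℝ) : Prop where
  adapted : ∀ x y : S, Adapted ℱ fun t ω => Γ t ω x y
  measurable : ∀ x y : S, Measurable fun p : Time T × Ω => Γ p.1 p.2 x y
  integrable : ∀ᵐ ω ∂μ, ∀ x : S, Integrable (fun t => Γ t ω x x) (lebesgue T)
  nonneg : ∀ᵐ ω ∂μ, ∀ (t : Time T) (x y : S), x ≠ y → 0 ≤ Γ t ω x y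
  diag : ∀ᵐ ω ∂μ, ∀ (t : Time T) (x : S),
    Γ t ω x x = -∑ y ∈ Finset.univ.filter (fun y => y ≠ x), Γ t ω x y
  kolmogorov : ∃ P : Time T → Time T → Ω → Matrix S S ℝ, IsCTransitionField μ ℱ X P ∧
    ∀ᵐ ω ∂μ, BackwardEquation (fun u => Γ u ω) (fun u v => P u v ω) ∧
      ForwardEquation (fun u => Γ u ω) (fun u v => P u v ω)

/-- `X` is an `(ℱ, 𝒢)`-CDMC (both a CMC and a DSMC) with intensity `Γ`. -/
structure IsCDMC [Fintype S] [DecidableEq S] [MeasurableSpace S] (hT : 0 < T) (μ : Measure Ω)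
    (ℱ 𝒢 : Filtration (Time T) mΩ) (X : Time T → Ω → S) (Γ : Time T → Ω → Matrix S S ℝ) :
    Prop where
  cmc : IsCMC μ ℱ 𝒢 X
  dsmc : IsDSMC hT μ ℱ 𝒢 X
  intensity : IsIntensity μ ℱ X Γ

/-- The conditional laws of the processes `X` and `Y` given the σ-algebra `m` coincide: every
measurable set of paths has the same conditional probability. Sets of paths are measurable for the
product σ-algebra, generated by the evaluations at fixed times. -/
def SameCondLaw [MeasurableSpace S] (μ : Measure Ω) (m : MeasurableSpace Ω)
    (X Y : Time T → Ω → S) : Prop :=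
  ∀ C : Set (Time T → S), MeasurableSet C →
    μ⟦{ω | (fun t => X t ω) ∈ C} | m⟧ =ᵐ[μ] μ⟦{ω | (fun t => Y t ω) ∈ C} | m⟧

end CondMarkov

/-! The c-transition field `P(s,t)` is the link between conditional laws and intensities. Law and
field: by double stochasticity, appending a later time to a cylinder event multiplies its
conditional probability given `ℱ_T` by a c-transition probability
(`condProb_inter_eq_condRatio_mul`, `IsDSMC.condProb_insert`). Hence the field and the conditional
initial law determine the conditional law. Conversely, the law given `ℱ_T` yields the law given
`ℱ_t` by the tower property, and with it the field. Field and intensity, path by path: if `P` solves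
the forward equation for `Γ` and `P'` the backward one for `Γ'`, then formally `d/du [P(v,u)
P'(u,t)] = P(v,u) (Γ_u - Γ'_u) P'(u,t)`, so a.e. equal intensities give `P = P'`;
`eq_of_forwardEquation_of_backwardEquation` replaces the product rule by Fubini. Conversely, if the
fields agree on a countable dense set of times, the forward equations give `P(v,u) Γ_u = P(v,u)
Γ'_u`, and letting `v ↑ u`, where `P(v,u) → I`, gives `Γ = Γ'` a.e.
(`intensity_ae_eq_of_transition_eq`). -/

namespace CondMarkov

/-! ### Integrals over intervals of a linear order -/

section Primitive

variable {I : Type*} [LinearOrder I] [TopologicalSpace I] [OrderTopology I]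
  [MeasurableSpace I] [BorelSpace I] {ν : Measure I}

/-- The primitive `p ↦ ∫_{(p.1, p.2]} h` of an integrable function is continuous. -/
theorem continuous_setIntegral_Ioc [SecondCountableTopology I]
    [NullSingletonClass ν] {h : I → ℝ} (hh : Integrable h ν) :
    Continuous fun p : I × I => ∫ u in Set.Ioc p.1 p.2, h u ∂ν := by
  simp_rw [← integral_indicator measurableSet_Ioc]
  rw [continuous_iff_continuousAt]
  rintro ⟨a, b⟩
  refine tendsto_integral_filter_of_dominated_convergence (fun u => ‖h u‖) ?_ ?_ hh.norm ?_
  · exact Eventually.of_forall fun p => hh.aestronglyMeasurable.indicator measurableSet_Ioc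
  · exact Eventually.of_forall fun p => Eventually.of_forall fun u => norm_indicator_le_norm_self _ _
  · have ha : ∀ᵐ u ∂ν, u ≠ a := by simp [ae_iff]
    have hb : ∀ᵐ u ∂ν, u ≠ b := by simp [ae_iff]
    filter_upwards [ha, hb] with u hua hub
    have h1 : ∀ᶠ p : I × I in 𝓝 (a, b), (p.1 < u ↔ a < u) := by
      rcases lt_or_gt_of_ne hua with h | h
      · filter_upwards [continuous_fst.continuousAt.eventually (lt_mem_nhds h)] with p hp
        exact iff_of_false hp.not_gt h.not_gt
      · filter_upwards [continuous_fst.continuousAt.eventually (gt_mem_nhds h)] with p hp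
        exact iff_of_true hp h
    have h2 : ∀ᶠ p : I × I in 𝓝 (a, b), (u ≤ p.2 ↔ u ≤ b) := by
      rcases lt_or_gt_of_ne hub with h | h
      · filter_upwards [continuous_snd.continuousAt.eventually (lt_mem_nhds h)] with p hp
        exact iff_of_true hp.le h.le
      · filter_upwards [continuous_snd.continuousAt.eventually (gt_mem_nhds h)] with p hp
        exact iff_of_false hp.not_ge h.not_ge
    refine tendsto_const_nhds.congr' ?_
    filter_upwards [h1, h2] with p hp1 hp2
    simp only [Set.indicator, Set.mem_Ioc, hp1, hp2]

/-- An integrable function whose integrals over all initial segments vanish is zero a.e. -/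
theorem ae_eq_zero_of_forall_setIntegral_Iic [OrderTop I] [SecondCountableTopology I]
    {h : I → ℝ} (hh : Integrable h ν) (h0 : ∀ t, ∫ u in Set.Iic t, h u ∂ν = 0) : h =ᵐ[ν] 0 := by
  have huniv : ∫ u, h u ∂ν = 0 := by simpa using h0 ⊤
  refine hh.ae_eq_zero_of_forall_setIntegral_eq_zero fun s hs hfin => ?_
  clear hfin
  induction s, hs using MeasurableSpace.induction_on_inter
    ((BorelSpace.measurable_eq (α := I)).trans (borel_eq_generateFrom_Iic I))
    isPiSystem_Iic with
  | empty => simp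
  | basic s hs =>
    obtain ⟨t, rfl⟩ := hs
    exact h0 t
  | compl s hs ih =>
    have := integral_add_compl hs hh
    rw [ih, huniv, zero_add] at this
    exact this
  | iUnion f hd hm ih =>
    rw [integral_iUnion hm hd hh.integrableOn]
    simp [ih]

/-- Interchange of the order of integration over the triangle `u < w`. -/
theorem integral_mul_setIntegral_Ioi [SecondCountableTopology I] [SFinite ν] {f g : I → ℝ}
    (hf : Integrable f ν) (hg : Integrable g ν) :
    Integrable (fun u => f u * ∫ w in Set.Ioi u, g w ∂ν) ν ∧
    Integrable (fun w => (∫ u in Set.Iio w, f u ∂ν) * g w) ν ∧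
    ∫ u, f u * (∫ w in Set.Ioi u, g w ∂ν) ∂ν = ∫ w, (∫ u in Set.Iio w, f u ∂ν) * g w ∂ν := by
  have hK : Integrable ({p : I × I | p.1 < p.2}.indicator fun p => f p.1 * g p.2) (ν.prod ν) :=
    (hf.mul_prod hg).indicator (measurableSet_lt measurable_fst measurable_snd)
  have e1 : ∀ u, f u * (∫ w in Set.Ioi u, g w ∂ν)
      = ∫ w, {p : I × I | p.1 < p.2}.indicator (fun p => f p.1 * g p.2) (u, w) ∂ν := by
    intro u
    rw [← integral_indicator measurableSet_Ioi, ← integral_const_mul]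
    congr 1 with w
    by_cases h : u < w <;> simp [h]
  have e2 : ∀ w, (∫ u in Set.Iio w, f u ∂ν) * g w
      = ∫ u, {p : I × I | p.1 < p.2}.indicator (fun p => f p.1 * g p.2) (u, w) ∂ν := by
    intro w
    rw [← integral_indicator measurableSet_Iio, ← integral_mul_const]
    congr 1 with u
    by_cases h : u < w <;> simp [h]
  simp_rw [e1, e2]
  exact ⟨hK.integral_prod_left, hK.integral_prod_right, integral_integral_swap hK⟩

end Primitive

/-! ### Kolmogorov equations along a single path -/

section Deterministic

variable {T : ℝ} {S : Type*} [Fintype S] [DecidableEq S]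

instance instNullSingletonClassLebesgue : NullSingletonClass (lebesgue T) where
  measure_singleton x := by
    rw [lebesgue, (MeasurableEmbedding.subtype_coe measurableSet_Icc).comap_apply]
    simp

instance instIsFiniteMeasureLebesgue : IsFiniteMeasure (lebesgue T) where
  measure_univ_lt_top := by
    rw [lebesgue, (MeasurableEmbedding.subtype_coe measurableSet_Icc).comap_apply]
    exact (measure_mono (t := Set.Icc 0 T) (by simp [Set.Icc])).trans_lt measure_Icc_lt_top

/-- Two matrix fields, one solving the forward and the other the backward Kolmogorov equation for
a.e. equal intensities, coincide. -/
theorem eq_of_forwardEquation_of_backwardEquation {Γ Γ' : Time T → Matrix S S ℝ}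
    {P P' : Time T → Time T → Matrix S S ℝ} (hP : ForwardEquation Γ P)
    (hP' : BackwardEquation Γ' P') (hΓ : ∀ᵐ u ∂(lebesgue T), Γ u = Γ' u)
    {v t : Time T} (hvt : v ≤ t) : P v t = P' v t := by
  ext x y
  set ν := (lebesgue T).restrict (Set.Ioc v t) with hν
  set A : Time T → Matrix S S ℝ := fun u => P v u * Γ u with hA
  set B : Time T → Matrix S S ℝ := fun u => Γ' u * P' u t with hB
  have iA : ∀ z, Integrable (fun u => A u x z) ν := fun z => (hP v t hvt x z).1
  have iB : ∀ z, Integrable (fun u => B u z y) ν := fun z => (hP' v t hvt z y).1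
  have hmem : ∀ᵐ u ∂ν, u ∈ Set.Ioc v t := ae_restrict_mem measurableSet_Ioc
  -- Expand both sides of `(P Γ) P' = P (Γ' P')` using `P'(u,t) = I + ∫_u^t B` and `P(v,u) = I +
  -- ∫_v^u A`. After integration in `u` the double integrals agree by Fubini, leaving `∫ A = ∫ B`.
  have key : ∀ᵐ u ∂ν, A u x y + ∑ z, A u x z * ∫ w in Set.Ioi u, B w z y ∂ν
      = B u x y + ∑ z, (∫ r in Set.Iio u, A r x z ∂ν) * B u z y := by
    filter_upwards [hmem, ae_restrict_of_ae hΓ] with u hu hΓu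
    have h1 : ∀ z, P' u t z y = (1 : Matrix S S ℝ) z y + ∫ w in Set.Ioi u, B w z y ∂ν := by
      intro z
      have := (hP' u t hu.2 z y).2
      rw [Matrix.sub_apply] at this
      rw [hν, Measure.restrict_restrict measurableSet_Ioi,
        show Set.Ioi u ∩ Set.Ioc v t = Set.Ioc u t by
          ext w; simp only [Set.mem_inter_iff, Set.mem_Ioi, Set.mem_Ioc]
          exact ⟨fun h => ⟨h.1, h.2.2⟩, fun h => ⟨h.1, hu.1.trans h.1, h.2⟩⟩]
      linarith
    have h2 : ∀ z, P v u x z = (1 : Matrix S S ℝ) x z + ∫ r in Set.Iio u, A r x z ∂ν := by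
      intro z
      have := (hP v u hu.1.le x z).2
      -- Dropping the endpoint `u` makes the domain match the strict triangle `r < u` of the Fubini
      -- lemma.
      rw [Matrix.sub_apply, integral_Ioc_eq_integral_Ioo] at this
      rw [hν, Measure.restrict_restrict measurableSet_Iio,
        show Set.Iio u ∩ Set.Ioc v t = Set.Ioo v u by
          ext w; simp only [Set.mem_inter_iff, Set.mem_Iio, Set.mem_Ioc, Set.mem_Ioo]
          exact ⟨fun h => ⟨h.2.1, h.1⟩, fun h => ⟨h.2, h.1, h.2.le.trans hu.2⟩⟩]
      linarith
    have h3 : (A u * P' u t) x y = (P v u * B u) x y := by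
      simp only [hA, hB, hΓu, Matrix.mul_assoc]
    rw [Matrix.mul_apply, Matrix.mul_apply] at h3
    simp only [h1, h2, mul_add, add_mul, Finset.sum_add_distrib] at h3
    simpa [Matrix.one_apply] using h3
  have sw := fun z => integral_mul_setIntegral_Ioi (iA z) (iB z)
  have hI := integral_congr_ae key
  rw [integral_add (iA y) (integrable_finsetSum _ fun z _ => (sw z).1),
    integral_add (iB x) (integrable_finsetSum _ fun z _ => (sw z).2.1),
    integral_finsetSum _ (fun z _ => (sw z).1), integral_finsetSum _ (fun z _ => (sw z).2.1),
    Finset.sum_congr rfl (fun z _ => (sw z).2.2)] at hI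
  have e1 := (hP v t hvt x y).2
  have e2 := (hP' v t hvt x y).2
  rw [Matrix.sub_apply] at e1 e2
  change _ = ∫ u, A u x y ∂ν at e1
  change _ = ∫ u, B u x y ∂ν at e2
  linarith

/-- Times in `(v, T]` can be approximated from above or below by elements of a dense set. -/
theorem dense_inter_Ici {D : Set (Time T)} (hD : Dense D) {v : Time T} (hv : v ∈ D) :
    Set.Ici v ⊆ closure (D ∩ Set.Ici v) := by
  intro t ht
  rcases eq_or_lt_of_le (Set.mem_Ici.1 ht) with rfl | hlt
  · exact subset_closure ⟨hv, ht⟩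
  · have h1 : t ∈ closure (Set.Ioi v ∩ D) :=
      hD.open_subset_closure_inter isOpen_Ioi hlt
    have h2 : Set.Ioi v ∩ D ⊆ D ∩ Set.Ici v := fun s hs => ⟨hs.2, Set.mem_Ici.2 (Set.mem_Ioi.1 hs.1).le⟩
    exact closure_mono h2 h1

/-- If `h` is integrable on `(v, T]` and its integrals over `(v, t]` vanish for all `t` in a dense
set, then `h` vanishes a.e. on `(v, T]`. -/
theorem ae_eq_zero_of_forall_setIntegral_Ioc (hT : 0 < T) {D : Set (Time T)} (hD : Dense D)
    {v : Time T} (hv : v ∈ D) {h : Time T → ℝ}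
    (hh : IntegrableOn h (Set.Ioc v (horizon hT)) (lebesgue T))
    (h0 : ∀ t ∈ D, v ≤ t → ∫ u in Set.Ioc v t, h u ∂(lebesgue T) = 0) :
    ∀ᵐ u ∂(lebesgue T), v < u → h u = 0 := by
  let _ : OrderTop (Time T) := { top := horizon hT, le_top := fun t => t.2.2 }
  have htop : ∀ u : Time T, u ≤ horizon hT := fun u => u.2.2
  -- Cutting `h` off outside `(v, T]` makes it globally integrable, so its primitive is continuous
  -- and vanishes for all `t ≥ v`, not only on `D`.
  set h' := (Set.Ioc v (horizon hT)).indicator h with hh'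
  have ih' : Integrable h' (lebesgue T) := hh.integrable_indicator measurableSet_Ioc
  have eI : ∀ t, ∫ u in Set.Ioc v t, h' u ∂(lebesgue T) = ∫ u in Set.Ioc v t, h u ∂(lebesgue T) :=
    fun t => setIntegral_congr_fun measurableSet_Ioc fun u hu => by
      simp [hh', hu.1, htop u]
  have hall : ∀ t, v ≤ t → ∫ u in Set.Ioc v t, h' u ∂(lebesgue T) = 0 := by
    intro t ht
    have hc : IsClosed {t | ∫ u in Set.Ioc v t, h' u ∂(lebesgue T) = 0} :=
      isClosed_eq ((continuous_setIntegral_Ioc ih').comp (by fun_prop : Continuous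
        fun t : Time T => (v, t))) continuous_const
    exact closure_minimal (fun s hs => (eI s).trans (h0 s hs.1 hs.2)) hc
      (dense_inter_Ici hD hv ht)
  have hz := ae_eq_zero_of_forall_setIntegral_Iic ih' fun t => by
    rcases le_or_gt v t with hvt | htv
    · refine Eq.trans ?_ (hall t hvt)
      refine setIntegral_eq_of_subset_of_forall_sdiff_eq_zero measurableSet_Iic
        (fun u hu => hu.2) fun u hu => Set.indicator_of_notMem (fun hu' => hu.2 ⟨hu'.1, hu.1⟩) h
    · exact setIntegral_eq_zero_of_forall_eq_zero fun u hu =>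
        Set.indicator_of_notMem (fun hu' => (hu'.1.trans_le hu).not_gt htv) h
  filter_upwards [hz] with u hu hvu
  simpa [hh', Set.indicator, hvu, htop u] using hu

/-- If two matrix fields coincide on a dense set of times and solve the Kolmogorov equations, then
the intensities coincide a.e. -/
theorem intensity_ae_eq_of_transition_eq (hT : 0 < T) {D : Set (Time T)} (hD : Dense D)
    (hDc : D.Countable) {Γ Γ' : Time T → Matrix S S ℝ} {P P' : Time T → Time T → Matrix S S ℝ}
    (hPf : ForwardEquation Γ P) (hPb : BackwardEquation Γ P) (hP' : ForwardEquation Γ' P')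
    (hPP' : ∀ v ∈ D, ∀ t ∈ D, v ≤ t → P v t = P' v t) :
    ∀ᵐ u ∂(lebesgue T), Γ u = Γ' u := by
  have h1 : ∀ v ∈ D, ∀ x y, ∀ᵐ u ∂(lebesgue T), v < u →
      (P v u * Γ u) x y = (P' v u * Γ' u) x y := by
    intro v hv x y
    have i1 := (hPf v (horizon hT) v.2.2 x y).1
    have i2 := (hP' v (horizon hT) v.2.2 x y).1
    have := ae_eq_zero_of_forall_setIntegral_Ioc hT hD hv (i1.sub i2) fun t ht hvt => by
      have e1 := (hPf v t hvt x y)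
      have e2 := (hP' v t hvt x y)
      simp only [Pi.sub_apply]
      rw [integral_sub e1.1 e2.1, ← e1.2, ← e2.2, hPP' v hv t ht hvt, sub_self]
    filter_upwards [this] with u hu hvu
    exact sub_eq_zero.1 (hu hvu)
  -- The forward integrands agree a.e., so integrating them back removes the restriction `t ∈ D`.
  have h2 : ∀ v ∈ D, ∀ t, v ≤ t → P v t = P' v t := by
    intro v hv t hvt
    ext x y
    have e1 := (hPf v t hvt x y).2
    have e2 := (hP' v t hvt x y).2
    rw [Matrix.sub_apply] at e1 e2
    have : ∫ u in Set.Ioc v t, (P v u * Γ u) x y ∂(lebesgue T)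
        = ∫ u in Set.Ioc v t, (P' v u * Γ' u) x y ∂(lebesgue T) :=
      setIntegral_congr_ae measurableSet_Ioc ((h1 v hv x y).mono fun u hu hvu => hu hvu.1)
    linarith
  -- Countability of `D` gives one null set of `u` for all `v`, so that `v` can tend to a fixed `u`.
  have h3 : ∀ᵐ u ∂(lebesgue T), ∀ v ∈ D, ∀ x y, v < u →
      (P v u * Γ u) x y = (P v u * Γ' u) x y := by
    rw [ae_ball_iff hDc]
    intro v hv
    rw [ae_all_iff]
    intro x
    rw [ae_all_iff]
    intro y
    filter_upwards [h1 v hv x y] with u hu hvu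
    rw [hu hvu, h2 v hv u hvu.le]
  have h0 : ∀ᵐ u ∂(lebesgue T), u ≠ initialTime hT := by simp [ae_iff]
  filter_upwards [h3, h0] with u hu hu0
  have hpos : initialTime hT < u := lt_of_le_of_ne u.2.1 hu0.symm
  -- This is where the backward equation enters: it controls `P(v,u)` as a function of its first
  -- time argument.
  have hlim : ∀ x y, Tendsto (fun v => P v u x y) (𝓝[<] u) (𝓝 ((1 : Matrix S S ℝ) x y)) := by
    intro x y
    have i := (hPb (initialTime hT) u hpos.le x y).1.integrable_indicator measurableSet_Ioc
    have hc := ((continuous_setIntegral_Ioc i).comp (by fun_prop : Continuous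
        fun v : Time T => (v, u))).tendsto u
    simp only [Function.comp_def, Set.Ioc_self, Measure.restrict_empty, integral_zero_measure] at hc
    have hc' := (hc.mono_left (nhdsWithin_le_nhds (s := Set.Iio u))).const_add
      ((1 : Matrix S S ℝ) x y)
    rw [add_zero] at hc'
    refine hc'.congr' ?_
    filter_upwards [self_mem_nhdsWithin] with v hv
    have e := (hPb v u (le_of_lt hv) x y).2
    rw [Matrix.sub_apply] at e
    rw [setIntegral_congr_fun (g := fun w => (Γ w * P w u) x y) measurableSet_Ioc fun w hw => by
      simp only [Set.indicator]
      rw [if_pos ⟨lt_of_le_of_lt v.2.1 hw.1, hw.2⟩]]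
    linarith
  have hne : (𝓝[D ∩ Set.Iio u] u).NeBot := by
    rw [← mem_closure_iff_nhdsWithin_neBot]
    have : u ∈ closure (Set.Iio u) := by
      rw [closure_Iio' (a := u) ⟨initialTime hT, hpos⟩]; exact Set.mem_Iic.2 le_rfl
    have h4 := closure_mono (hD.open_subset_closure_inter (isOpen_Iio (a := u))) this
    rwa [closure_closure, Set.inter_comm] at h4
  ext x y
  have hm : ∀ G : Matrix S S ℝ, Tendsto (fun v => (P v u * G) x y) (𝓝[D ∩ Set.Iio u] u)
      (𝓝 (G x y)) := by
    intro G
    have : Tendsto (fun v => ∑ z, P v u x z * G z y) (𝓝[D ∩ Set.Iio u] u)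
        (𝓝 (∑ z, (1 : Matrix S S ℝ) x z * G z y)) :=
      tendsto_finsetSum _ fun z _ =>
        ((hlim x z).mono_left (nhdsWithin_mono _ Set.inter_subset_right)).mul_const _
    rw [← Matrix.mul_apply, one_mul] at this
    exact this
  refine tendsto_nhds_unique_of_eventuallyEq (hm (Γ u)) (hm (Γ' u)) ?_
  filter_upwards [self_mem_nhdsWithin] with v hv
  exact hu v hv.1 x y hv.2

end Deterministic

/-! ### Ratios of conditional probabilities and one step of the chain -/

section CondRatio

variable {Ω S : Type*} {m m₁ 𝒢 mΩ : MeasurableSpace Ω} {μ : Measure Ω}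

/-- The ratio `ℙ(A | m) / ℙ(B | m)`, with the default value `c` where `ℙ(B | m)` vanishes. -/
noncomputable def condRatio (μ : Measure Ω) (m : MeasurableSpace Ω) (A B : Set Ω) (c : ℝ) :
    Ω → ℝ := fun ω =>
  if 0 < (μ⟦B | m⟧) ω then (μ⟦A | m⟧) ω / (μ⟦B | m⟧) ω else c

theorem measurable_condRatio (A B : Set Ω) (c : ℝ) :
    Measurable[m] (condRatio μ m A B c) := by
  have hA : Measurable[m] (μ⟦A | m⟧) := stronglyMeasurable_condExp.measurable
  have hB : Measurable[m] (μ⟦B | m⟧) := stronglyMeasurable_condExp.measurable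
  exact Measurable.ite (measurableSet_lt measurable_const hB) (hA.div hB) measurable_const

theorem condProb_nonneg (A : Set Ω) : 0 ≤ᵐ[μ] μ⟦A | m⟧ :=
  condExp_nonneg (Eventually.of_forall fun _ => Set.indicator_nonneg (fun _ _ => zero_le_one) _)

theorem integrable_indicator_one [IsProbabilityMeasure μ] {A : Set Ω} (hA : MeasurableSet[mΩ] A) :
    Integrable (A.indicator fun _ => (1 : ℝ)) μ :=
  (integrable_const 1).indicator hA

theorem condProb_mono [IsProbabilityMeasure μ] {A B : Set Ω} (hA : MeasurableSet[mΩ] A)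
    (hB : MeasurableSet B) (hAB : A ⊆ B) : μ⟦A | m⟧ ≤ᵐ[μ] μ⟦B | m⟧ :=
  condExp_mono (integrable_indicator_one hA) (integrable_indicator_one hB)
    (Eventually.of_forall fun _ => Set.indicator_le_indicator_of_subset hAB
      (fun _ => zero_le_one) _)

/-- The bound makes the ratio integrable and lets it be pulled out of conditional expectations. -/
theorem condRatio_bound [IsProbabilityMeasure μ] {A B : Set Ω} (hA : MeasurableSet[mΩ] A)
    (hB : MeasurableSet B) (hAB : A ⊆ B) {c : ℝ} (hc : |c| ≤ 1) :
    ∀ᵐ ω ∂μ, ‖condRatio μ m A B c ω‖ ≤ 1 := by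
  filter_upwards [condProb_nonneg (m := m) (μ := μ) A, condProb_mono (m := m) (μ := μ) hA hB hAB] with ω h1 h2
  simp only [Pi.zero_apply] at h1
  rw [condRatio, Real.norm_eq_abs]
  split_ifs with h
  · rw [abs_of_nonneg (div_nonneg h1 h.le)]
    exact div_le_one_of_le₀ h2 h.le
  · exact hc

/-- Where `ℙ(B | m)` vanishes so does `ℙ(A | m)`, since `A ⊆ B`; the default value `c` is therefore
immaterial. -/
theorem condRatio_mul [IsProbabilityMeasure μ] {A B : Set Ω} (hA : MeasurableSet[mΩ] A)
    (hB : MeasurableSet B) (hAB : A ⊆ B) (c : ℝ) :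
    condRatio μ m A B c * μ⟦B | m⟧ =ᵐ[μ] μ⟦A | m⟧ := by
  filter_upwards [condProb_nonneg (m := m) (μ := μ) A, condProb_nonneg (m := m) (μ := μ) B,
    condProb_mono (m := m) (μ := μ) hA hB hAB] with ω h1 h2 h3
  simp only [Pi.zero_apply] at h1 h2
  simp only [Pi.mul_apply, condRatio]
  split_ifs with h
  · field_simp
  · have h0 : (μ⟦B | m⟧) ω = 0 := le_antisymm (not_lt.1 h) h2
    rw [h0] at h3
    rw [h0, mul_zero, le_antisymm h3 h1]

/-- On an atom `{X = x}`, every set of `m ⊔ σ(X)` coincides with a set of `m`. -/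
theorem exists_inter_eq_of_measurableSet_sup_comap [MeasurableSpace S]
    (X : Ω → S) (x : S) {C : Set Ω}
    (hC : MeasurableSet[m ⊔ MeasurableSpace.comap X inferInstance] C) :
    ∃ H, MeasurableSet[m] H ∧ C ∩ X ⁻¹' {x} = H ∩ X ⁻¹' {x} := by
  -- The sets whose trace on `{X = x}` is the trace of a set of `m` form a σ-algebra; it remains to
  -- see that it contains `m` and `σ(X)`.
  let M : MeasurableSpace Ω :=
    { MeasurableSet' := fun C => ∃ H, MeasurableSet[m] H ∧ C ∩ X ⁻¹' {x} = H ∩ X ⁻¹' {x}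
      measurableSet_empty := ⟨∅, MeasurableSet.empty, rfl⟩
      measurableSet_compl := by
        rintro C ⟨H, hH, h⟩
        refine ⟨Hᶜ, hH.compl, ?_⟩
        ext ω
        have := Set.ext_iff.1 h ω
        simp only [Set.mem_inter_iff, Set.mem_compl_iff] at this ⊢
        tauto
      measurableSet_iUnion := by
        intro f hf
        choose H hH h using hf
        exact ⟨⋃ i, H i, MeasurableSet.iUnion hH, by simp only [Set.iUnion_inter, h]⟩ }
  have hm : m ≤ M := fun C hC => show ∃ H, _ from ⟨C, hC, rfl⟩
  have hX : MeasurableSpace.comap X inferInstance ≤ M := by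
    rintro _ ⟨B, -, rfl⟩
    by_cases hx : x ∈ B
    · refine ⟨Set.univ, @MeasurableSet.univ Ω m, ?_⟩
      ext ω
      simp only [Set.mem_inter_iff, Set.mem_preimage, Set.mem_singleton_iff, Set.mem_univ,
        true_and, and_iff_right_iff_imp]
      rintro rfl
      exact hx
    · refine ⟨∅, @MeasurableSet.empty Ω m, ?_⟩
      ext ω
      simp only [Set.mem_inter_iff, Set.mem_preimage, Set.mem_singleton_iff,
        Set.mem_empty_iff_false, false_and, iff_false, not_and]
      rintro h rfl
      exact hx h
  exact sup_le hm hX C hC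

/-- The conditional probability given `m ⊔ σ(X)` of an event contained in `{X = x}`. -/
theorem condProb_sup_comap_eq [MeasurableSpace S] [MeasurableSingletonClass S]
    [IsProbabilityMeasure μ] (hm : m ≤ mΩ) {X : Ω → S} (hX : Measurable X) (x : S) {A : Set Ω}
    (hA : MeasurableSet[mΩ] A) (hAx : A ⊆ X ⁻¹' {x}) {c : ℝ} (hc : |c| ≤ 1) :
    μ⟦A | m ⊔ MeasurableSpace.comap X inferInstance⟧
      =ᵐ[μ] (X ⁻¹' {x}).indicator (condRatio μ m A (X ⁻¹' {x}) c) := by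
  have hB : MeasurableSet (X ⁻¹' {x}) := hX (measurableSet_singleton x)
  have hle : m ⊔ MeasurableSpace.comap X inferInstance ≤ mΩ := sup_le hm hX.comap_le
  set q := condRatio μ m A (X ⁻¹' {x}) c with hq
  have qm : Measurable[m] q := measurable_condRatio A _ c
  have qb := condRatio_bound (m := m) (μ := μ) hA hB hAx hc
  have qi : Integrable q μ :=
    (integrable_const (1 : ℝ)).mono' (qm.mono hm le_rfl).aestronglyMeasurable qb
  symm
  refine ae_eq_condExp_of_forall_setIntegral_eq hle (integrable_indicator_one hA)
    (fun s _ _ => (qi.indicator hB).integrableOn) ?_ ?_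
  -- Both integrands vanish off `{X = x}`, so `C` may be exchanged for a set `H` of `m` with the
  -- same trace there, and the computation takes place over `m`.
  · intro C hC _
    obtain ⟨H, hH, hCH⟩ := exists_inter_eq_of_measurableSet_sup_comap (m := m) X x hC
    have hH' := hm H hH
    have e1 : ∀ (E : Set Ω) (f : Ω → ℝ), ∫ ω in E, (X ⁻¹' {x}).indicator f ω ∂μ
        = ∫ ω in E ∩ X ⁻¹' {x}, f ω ∂μ := fun E f => setIntegral_indicator hB
    have e2 : A.indicator (fun _ => (1 : ℝ))
        = (X ⁻¹' {x}).indicator (A.indicator fun _ => (1 : ℝ)) := by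
      rw [Set.indicator_indicator, Set.inter_eq_self_of_subset_right hAx]
    have e3 : (X ⁻¹' {x}).indicator q = q * (X ⁻¹' {x}).indicator fun _ => (1 : ℝ) := by
      ext ω
      simp [Set.indicator]
    have e4 : μ[q * (X ⁻¹' {x}).indicator (fun _ => (1 : ℝ)) | m] =ᵐ[μ] μ⟦A | m⟧ :=
      (condExp_stronglyMeasurable_mul_of_bound hm qm.stronglyMeasurable
        (integrable_indicator_one hB) 1 qb).trans (condRatio_mul hA hB hAx c)
    calc ∫ ω in C, (X ⁻¹' {x}).indicator q ω ∂μ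
        = ∫ ω in H, (X ⁻¹' {x}).indicator q ω ∂μ := by rw [e1, e1, hCH]
      _ = ∫ ω in H, (μ⟦A | m⟧) ω ∂μ := by
          rw [← setIntegral_condExp hm (qi.indicator hB) hH, e3]
          exact setIntegral_congr_ae hH' (e4.mono fun ω h _ => h)
      _ = ∫ ω in H, A.indicator (fun _ => (1 : ℝ)) ω ∂μ :=
          setIntegral_condExp hm (integrable_indicator_one hA) hH
      _ = ∫ ω in C, A.indicator (fun _ => (1 : ℝ)) ω ∂μ := by rw [e2, e1, e1, hCH]
  · have h1 : MeasurableSet[m ⊔ MeasurableSpace.comap X inferInstance] (X ⁻¹' {x}) :=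
      (le_sup_right : _ ≤ m ⊔ MeasurableSpace.comap X inferInstance) _
        ⟨{x}, measurableSet_singleton x, rfl⟩
    have h2 : Measurable[m ⊔ MeasurableSpace.comap X inferInstance] q := qm.mono le_sup_left le_rfl
    exact (h2.indicator h1).stronglyMeasurable.aestronglyMeasurable

/-- One step of a doubly stochastic chain: if `ℙ(C | m ∨ 𝒢) = ℙ(C | m₁ ∨ σ(X))` with `m₁ ≤ m`, then
for `A ∈ 𝒢` contained in `{X = x}` the conditional probability of `A ∩ C` given `m` factorizes. -/
theorem condProb_inter_eq_condRatio_mul [MeasurableSpace S] [MeasurableSingletonClass S]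
    [IsProbabilityMeasure μ] (hm : m ≤ mΩ) (hm₁ : m₁ ≤ m) (h𝒢 : 𝒢 ≤ mΩ) {X : Ω → S}
    (hX : Measurable X) (x : S) {A C : Set Ω} (hA : MeasurableSet[𝒢] A) (hAx : A ⊆ X ⁻¹' {x})
    (hC : MeasurableSet C)
    (hDS : μ⟦C | m ⊔ 𝒢⟧ =ᵐ[μ] μ⟦C | m₁ ⊔ MeasurableSpace.comap X inferInstance⟧)
    {c : ℝ} (hc : |c| ≤ 1) :
    μ⟦A ∩ C | m⟧ =ᵐ[μ] condRatio μ m₁ (C ∩ X ⁻¹' {x}) (X ⁻¹' {x}) c * μ⟦A | m⟧ := by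
  have hB : MeasurableSet (X ⁻¹' {x}) := hX (measurableSet_singleton x)
  have hle : m ⊔ 𝒢 ≤ mΩ := sup_le hm h𝒢
  have hA' : MeasurableSet A := h𝒢 A hA
  have hM₁ : m₁ ⊔ MeasurableSpace.comap X inferInstance ≤ mΩ :=
    sup_le (hm₁.trans hm) hX.comap_le
  have hBM : MeasurableSet[m₁ ⊔ MeasurableSpace.comap X inferInstance] (X ⁻¹' {x}) :=
    (le_sup_right : _ ≤ m₁ ⊔ MeasurableSpace.comap X inferInstance) _
      ⟨{x}, measurableSet_singleton x, rfl⟩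
  have hAM : MeasurableSet[m ⊔ 𝒢] A := (le_sup_right : 𝒢 ≤ m ⊔ 𝒢) _ hA
  set q := condRatio μ m₁ (C ∩ X ⁻¹' {x}) (X ⁻¹' {x}) c with hq
  have qm : Measurable[m] q := (measurable_condRatio _ _ c).mono hm₁ le_rfl
  have qb : ∀ᵐ ω ∂μ, ‖q ω‖ ≤ 1 :=
    condRatio_bound (m := m₁) (μ := μ) (hC.inter hB) hB Set.inter_subset_right hc
  -- By `hDS` the conditional probability given `m ⊔ 𝒢` reduces to one given `m₁ ⊔ σ(X)`, which on
  -- the atom `{X = x}` is the `m₁`-measurable ratio `q`.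
  have h1 : (X ⁻¹' {x}).indicator (μ⟦C | m ⊔ 𝒢⟧) =ᵐ[μ] (X ⁻¹' {x}).indicator q := by
    have h := condExp_indicator (μ := μ) (integrable_indicator_one hC) hBM
    rw [Set.indicator_indicator, Set.inter_comm] at h
    have h' := condProb_sup_comap_eq (μ := μ) (hm₁.trans hm) hX x (hC.inter hB)
      Set.inter_subset_right hc
    filter_upwards [hDS, h, h'] with ω e1 e2 e3
    rw [← e3, e2]
    simp only [Set.indicator, e1]
  have h2 : μ⟦A ∩ C | m ⊔ 𝒢⟧ =ᵐ[μ] q * A.indicator fun _ => (1 : ℝ) := by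
    have := condExp_indicator (μ := μ) (integrable_indicator_one hC) hAM
    rw [Set.indicator_indicator] at this
    refine this.trans ?_
    filter_upwards [h1] with ω hω
    by_cases hωA : ω ∈ A
    · have hωx := hAx hωA
      rw [Set.indicator_of_mem hωx, Set.indicator_of_mem hωx] at hω
      simp [hωA, hω]
    · simp [hωA]
  calc μ⟦A ∩ C | m⟧ =ᵐ[μ] μ[μ⟦A ∩ C | m ⊔ 𝒢⟧ | m] :=
        (condExp_condExp_of_le le_sup_left hle).symm
    _ =ᵐ[μ] μ[q * A.indicator (fun _ => (1 : ℝ)) | m] := condExp_congr_ae h2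
    _ =ᵐ[μ] q * μ⟦A | m⟧ := condExp_stronglyMeasurable_mul_of_bound hm qm.stronglyMeasurable
        (integrable_indicator_one hA') 1 qb

end CondRatio

/-! ### Conditional laws and their finite-dimensional marginals -/

section Laws

variable {T : ℝ} {Ω S : Type*} {m mΩ : MeasurableSpace Ω} {μ : Measure Ω} [IsProbabilityMeasure μ]

/-- Equality of conditional probabilities given `m` is equality of measures on the sets of `m`. -/
theorem condProb_ae_eq_iff (hm : m ≤ mΩ) {A B : Set Ω} (hA : MeasurableSet A)
    (hB : MeasurableSet B) :
    μ⟦A | m⟧ =ᵐ[μ] μ⟦B | m⟧ ↔ ∀ H, MeasurableSet[m] H → μ.restrict H A = μ.restrict H B := by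
  have e : ∀ (E : Set Ω), MeasurableSet E → ∀ H,
      ∫ ω in H, E.indicator (fun _ => (1 : ℝ)) ω ∂μ = (μ.restrict H).real E := by
    intro E hE H
    rw [integral_indicator hE]
    simp
  constructor
  · intro h H hH
    have := setIntegral_congr_ae (μ := μ) (hm H hH) (h.mono fun ω h _ => h)
    rw [setIntegral_condExp hm (integrable_indicator_one hA) hH,
      setIntegral_condExp hm (integrable_indicator_one hB) hH, e A hA, e B hB] at this
    exact (measureReal_eq_measureReal_iff).1 this
  · intro h
    refine ae_eq_condExp_of_forall_setIntegral_eq hm (integrable_indicator_one hB)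
      (fun _ _ _ => integrable_condExp.integrableOn) (fun H hH _ => ?_)
      stronglyMeasurable_condExp.aestronglyMeasurable
    rw [setIntegral_condExp hm (integrable_indicator_one hA) hH, e A hA, e B hB]
    simp only [Measure.real, h H hH]

theorem condProb_ae_eq_of_le {m₁ : MeasurableSpace Ω} (hm₁ : m₁ ≤ m) (hm : m ≤ mΩ) {A B : Set Ω}
    (h : μ⟦A | m⟧ =ᵐ[μ] μ⟦B | m⟧) : μ⟦A | m₁⟧ =ᵐ[μ] μ⟦B | m₁⟧ :=
  ((condExp_condExp_of_le hm₁ hm).symm.trans (condExp_congr_ae h)).trans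
    (condExp_condExp_of_le hm₁ hm)

variable [Fintype S] [MeasurableSpace S] [MeasurableSingletonClass S]

/-- The conditional law is determined by the conditional finite-dimensional probabilities at sets
of times containing a given one. -/
theorem sameCondLaw_of_finiteDimensional (hm : m ≤ mΩ) {X Y : Time T → Ω → S}
    (hX : ∀ t, Measurable (X t)) (hY : ∀ t, Measurable (Y t)) (t₀ : Time T)
    (h : ∀ (J : Finset (Time T)) (f : Time T → S),
      μ⟦{ω | ∀ i ∈ insert t₀ J, X i ω = f i} | m⟧
        =ᵐ[μ] μ⟦{ω | ∀ i ∈ insert t₀ J, Y i ω = f i} | m⟧) :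
    SameCondLaw μ m X Y := by
  have hXp : Measurable fun ω t => X t ω := measurable_pi_lambda _ hX
  have hYp : Measurable fun ω t => Y t ω := measurable_pi_lambda _ hY
  have hmeas : ∀ {W : Time T → Ω → S}, (∀ t, Measurable (W t)) → ∀ (J : Finset (Time T))
      (f : Time T → S), MeasurableSet {ω | ∀ i ∈ J, W i ω = f i} := by
    intro W hW J f
    simp only [Set.ofPred_forall]
    exact Finset.measurableSet_biInter _ fun i _ => hW i (measurableSet_singleton (f i))
  intro C hC
  refine (condProb_ae_eq_iff hm (hXp hC) (hYp hC)).2 fun H hH => ?_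
  have big : ∀ J : Finset (Time T),
      ((μ.restrict H).map fun ω t => X t ω).map (insert t₀ J).restrict
        = ((μ.restrict H).map fun ω t => Y t ω).map (insert t₀ J).restrict := by
    intro J
    refine Measure.ext_of_singleton fun g => ?_
    -- Outside the index set any value will do; `g` at `t₀` provides one, as `S` is not assumed
    -- nonempty.
    let f : Time T → S := fun i =>
      if hi : i ∈ insert t₀ J then g ⟨i, hi⟩ else g ⟨t₀, Finset.mem_insert_self _ _⟩
    have pre : ∀ W : Time T → Ω → S, (fun ω t => W t ω) ⁻¹' ((insert t₀ J).restrict ⁻¹' {g})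
        = {ω | ∀ i ∈ insert t₀ J, W i ω = f i} := by
      intro W
      ext ω
      refine funext_iff.trans ⟨fun h i hi => ?_, fun h i => ?_⟩
      · simp only [f, dif_pos hi]
        exact h ⟨i, hi⟩
      · have := h i i.2
        simp only [f, dif_pos i.2] at this
        exact this
    have hr : MeasurableSet ((insert t₀ J).restrict ⁻¹' {g} : Set (Time T → S)) :=
      Finset.measurable_restrict _ (measurableSet_singleton g)
    rw [Measure.map_apply (Finset.measurable_restrict _) (measurableSet_singleton g),
      Measure.map_apply (Finset.measurable_restrict _) (measurableSet_singleton g),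
      Measure.map_apply hXp hr, Measure.map_apply hYp hr, pre, pre]
    exact (condProb_ae_eq_iff hm (hmeas hX _ f) (hmeas hY _ f)).1 (h J f) H hH
  -- A finite measure on path space is determined by its marginals; the one at `J` is a projection
  -- of the one at `insert t₀ J`.
  have eq : (μ.restrict H).map (fun ω t => X t ω) = (μ.restrict H).map (fun ω t => Y t ω) := by
    refine IsProjectiveLimit.unique (P := fun I => ((μ.restrict H).map fun ω t => Y t ω).map
      I.restrict) (fun J => ?_) (fun _ => rfl)
    have hs : J ⊆ insert t₀ J := Finset.subset_insert _ _
    have hc : J.restrict (π := fun _ : Time T => S) =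
        Finset.restrict₂ (π := fun _ : Time T => S) hs ∘ (insert t₀ J).restrict := rfl
    beta_reduce
    rw [hc, ← Measure.map_map (Finset.measurable_restrict₂ _) (Finset.measurable_restrict _),
      ← Measure.map_map (Finset.measurable_restrict₂ _) (Finset.measurable_restrict _), big]
  have := congrArg (fun κ => κ C) eq
  simpa only [Measure.map_apply hXp hC, Measure.map_apply hYp hC] using this

end Laws

/-! ### Conditional finite-dimensional laws of doubly stochastic chains -/

section Chains

variable {T : ℝ} {Ω S : Type*} {mΩ : MeasurableSpace Ω} {μ : Measure Ω} [IsProbabilityMeasure μ]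
  {ℱ 𝒢 : Filtration (Time T) mΩ} [DecidableEq S] [MeasurableSpace S]
  [MeasurableSingletonClass S] {X Y : Time T → Ω → S}

/-- The entry `(x, y)` of the c-transition field of `X` between the times `s` and `t`. -/
noncomputable def cTransition (μ : Measure Ω) (ℱ : Filtration (Time T) mΩ) (X : Time T → Ω → S)
    (s t : Time T) (x y : S) : Ω → ℝ :=
  condRatio μ (ℱ t) (X t ⁻¹' {y} ∩ X s ⁻¹' {x}) (X s ⁻¹' {x}) (if x = y then 1 else 0)

/-- The conditional finite-dimensional probabilities of a doubly stochastic Markov chain are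
products of c-transition probabilities. -/
theorem IsDSMC.condProb_insert {hT : 0 < T} (hX : IsDSMC hT μ ℱ 𝒢 X) {J : Finset (Time T)}
    {s a : Time T} (hs : s ∈ J) (hJ : ∀ i ∈ J, i ≤ s) (hsa : s ≤ a) (f : Time T → S) :
    μ⟦{ω | ∀ i ∈ insert a J, X i ω = f i} | ℱ (horizon hT)⟧ =ᵐ[μ]
      cTransition μ ℱ X s a (f s) (f a) *
        μ⟦{ω | ∀ i ∈ J, X i ω = f i} | ℱ (horizon hT)⟧ := by
  have hm : ∀ t, Measurable (X t) := fun t => (hX.adapted t).mono (𝒢.le t) le_rfl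
  have hA : MeasurableSet[𝒢 s] {ω | ∀ i ∈ J, X i ω = f i} := by
    simp only [Set.ofPred_forall]
    refine Finset.measurableSet_biInter _ fun i hi => ?_
    exact 𝒢.mono (hJ i hi) _ (hX.adapted i (measurableSet_singleton (f i)))
  have hset : {ω | ∀ i ∈ insert a J, X i ω = f i}
      = {ω | ∀ i ∈ J, X i ω = f i} ∩ {ω | X a ω = f a} := by
    ext ω
    simp [and_comm]
  rw [hset]
  refine condProb_inter_eq_condRatio_mul (ℱ.le _) (ℱ.mono a.2.2) (𝒢.le s) (hm s) (f s) hA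
    (fun ω hω => hω s hs) (hm a (measurableSet_singleton (f a)))
    (hX.doublyStochastic s a (f a) hsa) ?_
  split_ifs <;> simp

/-- Two doubly stochastic Markov chains with the same c-transition fields and the same conditional
initial laws have the same conditional finite-dimensional probabilities. -/
theorem IsDSMC.condProb_finiteDimensional_eq {𝒢' : Filtration (Time T) mΩ} {hT : 0 < T}
    (hX : IsDSMC hT μ ℱ 𝒢 X) (hY : IsDSMC hT μ ℱ 𝒢' Y)
    (hq : ∀ s t x y, s ≤ t → cTransition μ ℱ X s t x y =ᵐ[μ] cTransition μ ℱ Y s t x y)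
    (h0 : ∀ x : S, μ⟦{ω | X (initialTime hT) ω = x} | ℱ (horizon hT)⟧
      =ᵐ[μ] μ⟦{ω | Y (initialTime hT) ω = x} | ℱ (horizon hT)⟧)
    (J : Finset (Time T)) (f : Time T → S) :
    μ⟦{ω | ∀ i ∈ insert (initialTime hT) J, X i ω = f i} | ℱ (horizon hT)⟧
      =ᵐ[μ] μ⟦{ω | ∀ i ∈ insert (initialTime hT) J, Y i ω = f i} | ℱ (horizon hT)⟧ := by
  induction J using Finset.induction_on_max with
  | empty => simpa using h0 (f (initialTime hT))
  | insert a J ha ih =>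
    -- The new time `a` exceeds all of `J`, so the step starts from the largest time of `insert 0
    -- J`. When `a = 0` this is a step from `0` to itself, which the non-strict inequality allows.
    rw [Finset.insert_comm]
    have hne : (insert (initialTime hT) J).Nonempty := Finset.insert_nonempty _ _
    have hmem := Finset.max'_mem _ hne
    have hle : (insert (initialTime hT) J).max' hne ≤ a := by
      refine Finset.max'_le _ _ _ fun i hi => ?_
      rcases Finset.mem_insert.1 hi with rfl | hi
      · exact a.2.1
      · exact (ha i hi).le
    have hmax := fun i hi => Finset.le_max' (insert (initialTime hT) J) i hi
    refine (hX.condProb_insert hmem hmax hle f).trans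
      (EventuallyEq.trans ?_ (hY.condProb_insert hmem hmax hle f).symm)
    exact (hq _ _ _ _ hle).mul ih

/-- The c-transition fields are determined by the conditional law given `ℱ_T`. -/
theorem SameCondLaw.cTransition_ae_eq {hT : 0 < T}
    (h : SameCondLaw μ (ℱ (horizon hT)) X Y) (s t : Time T) (x y : S) :
    cTransition μ ℱ X s t x y =ᵐ[μ] cTransition μ ℱ Y s t x y := by
  have hx : MeasurableSet ((fun w : Time T → S => w s) ⁻¹' {x}) :=
    measurable_pi_apply s (measurableSet_singleton x)
  have hy : MeasurableSet ((fun w : Time T → S => w t) ⁻¹' {y}) :=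
    measurable_pi_apply t (measurableSet_singleton y)
  have h1 : μ⟦X s ⁻¹' {x} | ℱ t⟧ =ᵐ[μ] μ⟦Y s ⁻¹' {x} | ℱ t⟧ :=
    condProb_ae_eq_of_le (ℱ.mono t.2.2) (ℱ.le _) (h _ hx)
  have h2 : μ⟦X t ⁻¹' {y} ∩ X s ⁻¹' {x} | ℱ t⟧ =ᵐ[μ] μ⟦Y t ⁻¹' {y} ∩ Y s ⁻¹' {x} | ℱ t⟧ :=
    condProb_ae_eq_of_le (ℱ.mono t.2.2) (ℱ.le _) (h _ (hy.inter hx))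
  filter_upwards [h1, h2] with ω e1 e2
  simp only [cTransition, condRatio, e1, e2]

end Chains

end CondMarkov

/-! ### The equivalence -/

theorem mainTheorem9 {T : ℝ} (hT : 0 < T)
    {Ω : Type*} [mΩ : MeasurableSpace Ω] (μ : Measure Ω) [IsProbabilityMeasure μ] [μ.IsComplete]
    (ℱ : Filtration (CondMarkov.Time T) mΩ) (hℱ : CondMarkov.UsualConditions μ ℱ)
    {S : Type*} [Fintype S] [DecidableEq S] [MeasurableSpace S] [MeasurableSingletonClass S]
    (Z U : CondMarkov.Time T → Ω → S)
    (hZm : ∀ t, Measurable (Z t)) (hUm : ∀ t, Measurable (U t))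
    (ΓZ ΓU : CondMarkov.Time T → Ω → Matrix S S ℝ)
    (hZ : CondMarkov.IsCDMC hT μ ℱ (CondMarkov.processFiltration μ Z hZm) Z ΓZ)
    (hU : CondMarkov.IsCDMC hT μ ℱ (CondMarkov.processFiltration μ U hUm) U ΓU) :
    CondMarkov.SameCondLaw μ (ℱ (CondMarkov.horizon hT)) Z U ↔
      (∀ᵐ p ∂((CondMarkov.lebesgue T).prod μ), ΓZ p.1 p.2 = ΓU p.1 p.2) ∧
      (∀ x : S,
        μ⟦{ω | Z (CondMarkov.initialTime hT) ω = x} | ℱ (CondMarkov.horizon hT)⟧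
          =ᵐ[μ] μ⟦{ω | U (CondMarkov.initialTime hT) ω = x} | ℱ (CondMarkov.horizon hT)⟧) := by
  obtain ⟨P, hP, hPk⟩ := hZ.intensity.kolmogorov
  obtain ⟨Q, hQ, hQk⟩ := hU.intensity.kolmogorov
  have hms : MeasurableSet {p : CondMarkov.Time T × Ω | ΓZ p.1 p.2 = ΓU p.1 p.2} := by
    simp only [← Matrix.ext_iff, Set.ofPred_forall]
    exact MeasurableSet.iInter fun x => MeasurableSet.iInter fun y =>
      measurableSet_eq_fun (hZ.intensity.measurable x y) (hU.intensity.measurable x y)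
  -- Fubini turns the `du ⊗ dℙ` statement into a pathwise one, to which the deterministic lemmas
  -- apply.
  have hΓiff : (∀ᵐ p ∂((CondMarkov.lebesgue T).prod μ), ΓZ p.1 p.2 = ΓU p.1 p.2) ↔
      ∀ᵐ ω ∂μ, ∀ᵐ u ∂(CondMarkov.lebesgue T), ΓZ u ω = ΓU u ω := by
    rw [Measure.ae_prod_iff_ae_ae hms, Measure.ae_ae_comm hms]
  rw [hΓiff]
  constructor
  · intro h
    refine ⟨?_, fun x => h _ (measurable_pi_apply _ (measurableSet_singleton x))⟩
    -- The versions `P` and `Q` are compared only up to a null set for each pair of times, so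
    -- simultaneous equality is available on countably many pairs.
    obtain ⟨D, hDc, hD⟩ := TopologicalSpace.exists_countable_dense (CondMarkov.Time T)
    have hPQ : ∀ᵐ ω ∂μ, ∀ v ∈ D, ∀ t ∈ D, v ≤ t → P v t ω = Q v t ω := by
      rw [ae_ball_iff hDc]
      intro v _
      rw [ae_ball_iff hDc]
      intro t _
      rw [ae_all_iff]
      intro hvt
      simp only [← Matrix.ext_iff, ae_all_iff]
      exact fun x y => EventuallyEq.trans (hP v t hvt x y)
        ((h.cTransition_ae_eq v t x y).trans (EventuallyEq.symm (hQ v t hvt x y)))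
    filter_upwards [hPQ, hPk, hQk] with ω e1 e2 e3
    exact CondMarkov.intensity_ae_eq_of_transition_eq hT hD hDc e2.2 e2.1 e3.2 e1
  · rintro ⟨hΓ, h0⟩
    refine CondMarkov.sameCondLaw_of_finiteDimensional (ℱ.le _) hZm hUm
      (CondMarkov.initialTime hT)
      (hZ.dsmc.condProb_finiteDimensional_eq hU.dsmc (fun s t x y hst => ?_) h0)
    -- `IsCTransitionField` unfolds to a.e. equality with `cTransition`, so it suffices to compare
    -- `P` and `Q`: the forward equation of the first against the backward equation of the second.
    refine EventuallyEq.trans (EventuallyEq.symm (hP s t hst x y))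
      (EventuallyEq.trans ?_ (hQ s t hst x y))
    filter_upwards [hΓ, hPk, hQk] with ω e1 e2 e3
    rw [CondMarkov.eq_of_forwardEquation_of_backwardEquation e2.2 e3.1 e1 hst]
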